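/- Let $\mathbb{R}^n$ carry the lattice $\mathbb{Z}^n$. For a full-dimensional compact convex set $K\subseteq\mathbb{R}^n$ and $1\le i\le n$, the $i$-th covering minimum $\mu_i(K)$ is the least $\mu\ge 0$ such that $\mu K+\mathbb{Z}^n$ meets every $(n-i)$-dimensional affine subspace of $\mathbb{R}^n$, and the covering radius $\mu(K)$ is the least $\mu\ge0$ with $\mu K+\mathbb{Z}^n=\mathbb{R}^n$. A lattice $n$-polytope is a full-dimensional polytope in $\mathbb{R}^n$ that is the convex hull of finitely many points of $\mathbb{Z}^n$; it is non-hollow if its interior contains a point of $\mathbb{Z}^n$. Let $T_n=\operatorname{conv}(-\mathbb{1}_n,e_1,\dots,e_n)\subseteq\mathbb{R}^n$ be the standard terminal simplex, where $\mathbb{1}_n=(1,\dots,1)$. A terminal $n$-polytope is a lattice $n$-polytope of the form $$K_1\oplus\cdots\oplus K_k=\Big\{\sum_{j=1}^k\lambda_jx_j \;:\; x_j\in K_j,\ \lambda_j\ge0,\ \sum_{j=1}^k\lambda_j=1\Big\},$$ where $\mathbb{R}^n=\mathbb{R}^{l_1}\oplus\cdots\oplus\mathbb{R}^{l_k}$ is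 a decomposition into coordinate subspaces of dimensions $l_j\ge1$ and each $K_j=u_j+T_{l_j}\subseteq\mathbb{R}^{l_j}$ is a translate of $T_{l_j}$ containing the origin. **Proposition.** For every $d\in\mathbb{N}$ the following are equivalent: (i) $\mu(P)\le\frac i2$ for every $1\le i\le d$ and every non-hollow lattice $i$-polytope $P$; (ii) $\mu_i(T_n)=\frac i2$ for every $n\ge d$ and every $1\le i\le d$; (iii) $\mu_i(T)=\frac i2$ for every $n\ge d$, every terminal $n$-polytope $T$ and every $1\le i\le d$. -/

import Mathlib

open scoped Pointwise

/-- The integer lattice `ℤⁿ ⊆ ℝⁿ`. Throughout, `ℝⁿ` is `Fin n → ℝ`; only its linear, affine and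
topological structure is used, never a norm. -/
def integerLattice (n : ℕ) : Set (Fin n → ℝ) :=
  Set.range fun (z : Fin n → ℤ) (j : Fin n) => (z j : ℝ)

/-- The `i`-th covering minimum of `K ⊆ ℝⁿ` with respect to `Λ`, for `1 ≤ i ≤ n`: the smallest
`μ ≥ 0` such that `μ K + Λ` meets every affine subspace of dimension `n - i`. -/
noncomputable def coveringMinimum {n : ℕ} (i : ℕ) (K Λ : Set (Fin n → ℝ)) : ℝ :=
  sInf {μ : ℝ | 0 ≤ μ ∧ ∀ U : AffineSubspace ℝ (Fin n → ℝ), (U : Set (Fin n → ℝ)).Nonempty →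
    Module.finrank ℝ U.direction + i = n → ((μ • K + Λ) ∩ (U : Set (Fin n → ℝ))).Nonempty}

/-- The covering radius of `K ⊆ ℝⁿ` with respect to `Λ`: the smallest `μ ≥ 0` such that
`μ K + Λ = ℝⁿ`. -/
noncomputable def coveringRadius {n : ℕ} (K Λ : Set (Fin n → ℝ)) : ℝ :=
  sInf {μ : ℝ | 0 ≤ μ ∧ μ • K + Λ = Set.univ}

/-- `K` is hollow with respect to `Λ`: no point of `Λ` lies in the interior of `K`. -/
def IsHollow {n : ℕ} (K Λ : Set (Fin n → ℝ)) : Prop :=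
  interior K ∩ Λ = ∅

/-- A lattice `n`-polytope: a full-dimensional polytope in `ℝⁿ`, the convex hull of finitely many
points of `ℤⁿ`. -/
def IsLatticePolytope {n : ℕ} (P : Set (Fin n → ℝ)) : Prop :=
  affineSpan ℝ P = ⊤ ∧
    ∃ S : Set (Fin n → ℝ), S.Finite ∧ S ⊆ integerLattice n ∧ P = convexHull ℝ S

/-- The standard terminal simplex `Tₙ = conv(-𝟙, e₁, …, eₙ)`. -/
def terminalSimplex (n : ℕ) : Set (Fin n → ℝ) :=
  convexHull ℝ (insert (fun _ => -1) (Set.range fun j : Fin n => Pi.single j 1))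

/-- The direct sum `K₁ ⊕ ⋯ ⊕ K_k = {∑ⱼ λⱼ xⱼ : xⱼ ∈ Kⱼ, λⱼ ≥ 0, ∑ⱼ λⱼ = 1}` of convex sets that
contain the origin and lie in complementary linear subspaces of `ℝⁿ`. -/
def convexDirectSum {n k : ℕ} (K : Fin k → Set (Fin n → ℝ)) : Set (Fin n → ℝ) :=
  {y | ∃ c ∈ stdSimplex ℝ (Fin k), ∃ x : Fin k → Fin n → ℝ,
    (∀ j, x j ∈ K j) ∧ y = ∑ j, c j • x j}

/-- For a splitting `e` of the `n` coordinates into `k` blocks of sizes `l 0, …, l (k - 1)`, the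
inclusion of `ℝ^(l j)` into `ℝⁿ = ℝ^(l 0) ⊕ ⋯ ⊕ ℝ^(l (k - 1))` as the `j`-th summand. -/
def blockInclusion {n k : ℕ} {l : Fin k → ℕ} (e : (Σ j : Fin k, Fin (l j)) ≃ Fin n) (j : Fin k)
    (x : Fin (l j) → ℝ) : Fin n → ℝ :=
  fun a => (Pi.single j x : ∀ j : Fin k, Fin (l j) → ℝ) (e.symm a).1 (e.symm a).2

/-- A terminal `n`-polytope: a lattice `n`-polytope that is the direct sum of translates, each
containing the origin, of standard terminal simplices of positive dimensions `l j`, with respect to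
a decomposition `ℝⁿ = ⨁ⱼ ℝ^(l j)` into coordinate subspaces. -/
def IsTerminalPolytope {n : ℕ} (T : Set (Fin n → ℝ)) : Prop :=
  IsLatticePolytope T ∧
    ∃ (k : ℕ) (l : Fin k → ℕ) (e : (Σ j : Fin k, Fin (l j)) ≃ Fin n)
      (u : ∀ j : Fin k, Fin (l j) → ℝ),
      (∀ j, 0 < l j) ∧
      (∀ j, (0 : Fin (l j) → ℝ) ∈ (fun x => u j + x) '' terminalSimplex (l j)) ∧
      T = convexDirectSum fun j =>
        blockInclusion e j '' ((fun x => u j + x) '' terminalSimplex (l j))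

/-!
The three conditions are shown equivalent in the cycle covering radii, terminal polytopes, standard
terminal simplices, covering radii.

*Covering radii bound covering minima* (`meetsFlats_of_coveringRadius_le`). Let `K` be a lattice
polytope with the origin in its interior, and project along the direction `V` of a flat of
codimension `i`. If `ℤⁿ` projects to a lattice then `K` projects to a non-hollow lattice
`i`-polytope, and the bound `i / 2` on its covering radius applies. If not, some integer vector `w`
has a short nonzero projection; a flat with direction `V + ℝ w` has codimension `i - 1`, and a point
where it is met is moved into the original flat by a multiple of `w`, whose integer part stays in
the lattice and whose fractional part is absorbed by a small dilate of `K`. This avoids any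
approximation of irrational flats by rational ones.

*Direct sums* (`meetsFlats_convexDirectSum`). A terminal polytope may have the origin on its
boundary, so the previous step is applied to its summands, whose covering minima do not change
under translation. A subspace `V` of codimension `i` splits along the blocks of coordinates into
subspaces with codimensions of sum `i`, so bounds of the form `i / 2` add up.

*Lower bound* (`half_le_of_meetsFlats`). Prescribe `i` coordinates. If `m` of them lie in a block
then the point with these coordinates equal to `1/(m+1), …, m/(m+1)` is not reached modulo `ℤ` by a
dilate of the terminal simplex by a factor less than `m / 2` (`half_card_le_of_deep_hole`), since
`m + 1` distinct nonnegative integers add up to at least `m (m + 1) / 2`.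

*Covering minima of `Tₙ` bound covering radii* (`coveringRadius_le_of_coveringMinimum`). After a
translation a non-hollow lattice `i`-polytope `P` has the origin in its interior, so its generating
points satisfy a linear relation with positive coefficients. By simultaneous Diophantine
approximation the coefficients can be taken to be integers. Repeating points, one gets
`n + 1` lattice points of `P` that add up to zero, and these are the images of the vertices of `Tₙ`
under an integral projection `ℝⁿ → ℝⁱ`. The fibres of the projection are flats of codimension `i`.
-/

/-! ### The integer lattice and flats -/

theorem mem_integerLattice {n : ℕ} {x : Fin n → ℝ} :
    x ∈ integerLattice n ↔ ∀ j, ∃ m : ℤ, x j = m := by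
  constructor
  · rintro ⟨z, rfl⟩ j
    exact ⟨z j, rfl⟩
  · intro h
    choose z hz using h
    exact ⟨z, funext fun j => (hz j).symm⟩

theorem zero_mem_integerLattice (n : ℕ) : (0 : Fin n → ℝ) ∈ integerLattice n :=
  ⟨0, by ext; simp⟩

theorem add_mem_integerLattice {n : ℕ} {x y : Fin n → ℝ} (hx : x ∈ integerLattice n)
    (hy : y ∈ integerLattice n) : x + y ∈ integerLattice n := by
  obtain ⟨a, rfl⟩ := hx
  obtain ⟨b, rfl⟩ := hy
  exact ⟨a + b, by ext; simp⟩

theorem zsmul_mem_integerLattice {n : ℕ} (m : ℤ) {x : Fin n → ℝ} (hx : x ∈ integerLattice n) :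
    (m : ℝ) • x ∈ integerLattice n := by
  obtain ⟨a, rfl⟩ := hx
  exact ⟨m • a, by ext; simp⟩

theorem sub_mem_integerLattice {n : ℕ} {x y : Fin n → ℝ} (hx : x ∈ integerLattice n)
    (hy : y ∈ integerLattice n) : x - y ∈ integerLattice n := by
  obtain ⟨a, rfl⟩ := hx
  obtain ⟨b, rfl⟩ := hy
  exact ⟨a - b, by ext; simp⟩

/-- `μ K + ℤⁿ` meets every flat `x + V` of codimension `i`. The flat is given by a base point and
its direction, so that linear algebra applies to `V`. -/
def MeetsFlats {n : ℕ} (i : ℕ) (μ : ℝ) (K : Set (Fin n → ℝ)) : Prop :=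
  ∀ V : Submodule ℝ (Fin n → ℝ), Module.finrank ℝ V + i = n → ∀ x : Fin n → ℝ,
    ∃ v ∈ V, ∃ t ∈ K, ∃ z ∈ integerLattice n, x + v = μ • t + z

theorem meetsFlats_iff {n : ℕ} {i : ℕ} {μ : ℝ} {K : Set (Fin n → ℝ)} :
    (∀ U : AffineSubspace ℝ (Fin n → ℝ), (U : Set (Fin n → ℝ)).Nonempty →
      Module.finrank ℝ U.direction + i = n →
        ((μ • K + integerLattice n) ∩ (U : Set (Fin n → ℝ))).Nonempty) ↔ MeetsFlats i μ K := by
  constructor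
  · intro h V hV x
    obtain ⟨y, hy, hyU⟩ := h (AffineSubspace.mk' x V)
      ⟨x, AffineSubspace.self_mem_mk' x V⟩ (by rwa [AffineSubspace.direction_mk'])
    obtain ⟨_, ⟨t, ht, rfl⟩, z, hz, rfl⟩ := hy
    refine ⟨_, (AffineSubspace.mem_mk').1 hyU, t, ht, z, hz, ?_⟩
    simp
  · rintro h U ⟨x, hx⟩ hU
    obtain ⟨v, hv, t, ht, z, hz, hvt⟩ := h U.direction hU x
    refine ⟨x + v, ?_, ?_⟩
    · rw [hvt]
      exact Set.add_mem_add (Set.smul_mem_smul_set ht) hz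
    · rw [add_comm]
      exact AffineSubspace.vadd_mem_of_mem_direction hv hx

theorem coveringMinimum_eq {n : ℕ} (i : ℕ) (K : Set (Fin n → ℝ)) :
    coveringMinimum i K (integerLattice n) = sInf {μ : ℝ | 0 ≤ μ ∧ MeetsFlats i μ K} := by
  unfold coveringMinimum
  congr 1
  ext μ
  exact and_congr_right fun _ => meetsFlats_iff

theorem smul_mem_of_zero_mem {E : Type*} [AddCommGroup E] [Module ℝ E] {K : Set E}
    (hK : Convex ℝ K) (h0 : (0 : E) ∈ K) {a b : ℝ} (ha : 0 ≤ a) (hab : a ≤ b) {t : E}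
    (ht : t ∈ K) : ∃ s ∈ K, a • t = b • s := by
  rcases eq_or_lt_of_le (ha.trans hab) with hb | hb
  · have : a = 0 := le_antisymm (hb ▸ hab) ha
    exact ⟨0, h0, by simp [this]⟩
  · refine ⟨(a / b) • t, ?_, ?_⟩
    · exact hK.smul_mem_of_zero_mem h0 ht ⟨by positivity, (div_le_one hb).2 hab⟩
    · rw [smul_smul, mul_div_cancel₀ _ hb.ne']

theorem add_smul_mem {E : Type*} [AddCommGroup E] [Module ℝ E] {K : Set E}
    (hK : Convex ℝ K) {a b : ℝ} (ha : 0 ≤ a) (hb : 0 ≤ b) {s t : E} (hs : s ∈ K) (ht : t ∈ K) :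
    ∃ r ∈ K, a • s + b • t = (a + b) • r := by
  have : a • s + b • t ∈ (a + b) • K := by
    rw [hK.add_smul ha hb]
    exact Set.add_mem_add (Set.smul_mem_smul_set hs) (Set.smul_mem_smul_set ht)
  obtain ⟨r, hr, h⟩ := this
  exact ⟨r, hr, h.symm⟩

/-! ### From the covering radius in dimension `i` to flats of codimension `i` -/

/-- Some dilate of a neighbourhood of the origin covers space together with its integer
translates, so the infimum defining the covering radius is over a nonempty set. -/
theorem exists_smul_add_integerLattice_eq_univ {i : ℕ} {P : Set (Fin i → ℝ)}
    (h0 : (0 : Fin i → ℝ) ∈ interior P) : ∃ μ : ℝ, 0 ≤ μ ∧ μ • P + integerLattice i = Set.univ := by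
  obtain ⟨r, hr, hb⟩ := Metric.mem_nhds_iff.1 (mem_interior_iff_mem_nhds.1 h0)
  refine ⟨2 / r, by positivity, Set.eq_univ_of_forall fun x => ?_⟩
  have hx : (fun j => Int.fract (x j)) + (fun j => ((⌊x j⌋ : ℤ) : ℝ)) = x := by
    ext j
    simp [Int.fract_add_floor]
  rw [← hx]
  refine Set.add_mem_add ?_ ⟨fun j => ⌊x j⌋, rfl⟩
  rw [Set.mem_smul_set_iff_inv_smul_mem₀ (by positivity)]
  apply hb
  rw [mem_ball_zero_iff, inv_div]
  refine (pi_norm_lt_iff hr).2 fun j => ?_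
  rw [Pi.smul_apply, smul_eq_mul, norm_mul, Real.norm_of_nonneg (by positivity),
    Real.norm_of_nonneg (Int.fract_nonneg _)]
  nlinarith [Int.fract_lt_one (x j), Int.fract_nonneg (x j)]

/-- The image of `ℤⁿ` under a linear map. -/
def mapLattice {n i : ℕ} (π : (Fin n → ℝ) →ₗ[ℝ] (Fin i → ℝ)) : Submodule ℤ (Fin i → ℝ) where
  carrier := π '' integerLattice n
  add_mem' := by
    rintro _ _ ⟨a, ha, rfl⟩ ⟨b, hb, rfl⟩
    exact ⟨a + b, add_mem_integerLattice ha hb, map_add _ _ _⟩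
  zero_mem' := ⟨0, zero_mem_integerLattice n, map_zero _⟩
  smul_mem' := by
    rintro m _ ⟨a, ha, rfl⟩
    exact ⟨(m : ℝ) • a, zsmul_mem_integerLattice m ha, by rw [map_smul, Int.cast_smul_eq_zsmul]⟩

theorem single_mem_integerLattice {n : ℕ} (j : Fin n) :
    (Pi.single j 1 : Fin n → ℝ) ∈ integerLattice n :=
  ⟨Pi.single j 1, by ext a; by_cases h : a = j <;> simp [h]⟩

theorem span_mapLattice {n i : ℕ} {π : (Fin n → ℝ) →ₗ[ℝ] (Fin i → ℝ)}
    (hπ : Function.Surjective π) : Submodule.span ℝ (mapLattice π : Set (Fin i → ℝ)) = ⊤ := by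
  have : Submodule.span ℝ (integerLattice n) = ⊤ := by
    refine eq_top_iff.2 ((Pi.basisFun ℝ (Fin n)).span_eq.symm.le.trans (Submodule.span_mono ?_))
    rintro _ ⟨j, rfl⟩
    simpa using single_mem_integerLattice j
  change Submodule.span ℝ (π '' integerLattice n) = ⊤
  rw [Submodule.span_image, this, Submodule.map_top, LinearMap.range_eq_top.2 hπ]

/-- If `π(ℤⁿ)` is discrete then a change of coordinates turns it into `ℤⁱ`. -/
theorem exists_equiv_mapLattice {n i : ℕ} {π : (Fin n → ℝ) →ₗ[ℝ] (Fin i → ℝ)}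
    (hπ : Function.Surjective π) [DiscreteTopology (mapLattice π)] :
    ∃ φ : (Fin i → ℝ) ≃ₗ[ℝ] (Fin i → ℝ), ∀ y, y ∈ π '' integerLattice n ↔ φ y ∈ integerLattice i := by
  have : IsZLattice ℝ (mapLattice π) := ⟨span_mapLattice hπ⟩
  have := ZLattice.module_free ℝ (mapLattice π)
  have := ZLattice.module_finite ℝ (mapLattice π)
  have hr : Module.finrank ℤ (mapLattice π) = i := by
    rw [ZLattice.rank ℝ, Module.finrank_fin_fun]
  let b := (Module.finBasisOfFinrankEq ℤ (mapLattice π) hr)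
  let B := b.ofZLatticeBasis ℝ (mapLattice π)
  refine ⟨B.equivFun, fun y => ?_⟩
  change y ∈ mapLattice π ↔ _
  constructor
  · intro hy
    refine ⟨fun j => b.repr ⟨y, hy⟩ j, funext fun j => ?_⟩
    exact (b.ofZLatticeBasis_repr_apply ℝ (mapLattice π) ⟨y, hy⟩ j).symm
  · rintro ⟨z, hz⟩
    rw [← B.sum_equivFun y, ← hz]
    refine sum_mem fun j _ => ?_
    rw [Int.cast_smul_eq_zsmul]
    refine Submodule.smul_mem _ _ ?_
    simp [B, Module.Basis.ofZLatticeBasis_apply]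

/-- If `π(ℤⁿ)` is not discrete then it has arbitrarily short nonzero vectors. -/
theorem exists_short_of_not_discrete {n i : ℕ} {π : (Fin n → ℝ) →ₗ[ℝ] (Fin i → ℝ)}
    (h : ¬ DiscreteTopology (mapLattice π)) {δ : ℝ} (hδ : 0 < δ) :
    ∃ z ∈ integerLattice n, π z ≠ 0 ∧ ‖π z‖ < δ := by
  by_contra! hc
  refine h (discreteTopology_of_isOpen_singleton_zero ?_)
  rw [Metric.isOpen_singleton_iff]
  refine ⟨δ, hδ, ?_⟩
  rintro ⟨_, z, hz, rfl⟩ hd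
  by_contra hne
  have := hc z hz (fun h0 => hne (Subtype.ext h0))
  rw [dist_zero_right] at hd
  exact absurd hd (not_lt.2 this)

theorem exists_surjective_ker_eq {n i : ℕ} (V : Submodule ℝ (Fin n → ℝ))
    (hV : Module.finrank ℝ V + i = n) :
    ∃ π : (Fin n → ℝ) →ₗ[ℝ] (Fin i → ℝ), Function.Surjective π ∧ LinearMap.ker π = V := by
  have h := V.finrank_quotient_add_finrank
  rw [Module.finrank_fin_fun] at h
  have e : ((Fin n → ℝ) ⧸ V) ≃ₗ[ℝ] (Fin i → ℝ) :=
    LinearEquiv.ofFinrankEq _ _ (by rw [Module.finrank_fin_fun]; omega)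
  refine ⟨e.toLinearMap ∘ₗ V.mkQ, ?_, ?_⟩
  · exact e.surjective.comp V.mkQ_surjective
  · rw [LinearEquiv.ker_comp, Submodule.ker_mkQ]

/-- The bound on covering radii in dimension `i`, in the discrete case. -/
theorem meets_of_discrete {n i : ℕ}
    (H : ∀ P : Set (Fin i → ℝ), IsLatticePolytope P →
        ¬ IsHollow P (integerLattice i) → coveringRadius P (integerLattice i) ≤ (i : ℝ) / 2)
    {S : Set (Fin n → ℝ)} (hS : S.Finite) (hSZ : S ⊆ integerLattice n)
    (h0 : (0 : Fin n → ℝ) ∈ interior (convexHull ℝ S))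
    {π : (Fin n → ℝ) →ₗ[ℝ] (Fin i → ℝ)} (hπ : Function.Surjective π)
    [DiscreteTopology (mapLattice π)] {ε : ℝ} (hε : 0 < ε) (x : Fin n → ℝ) :
    ∃ v ∈ LinearMap.ker π, ∃ t ∈ convexHull ℝ S, ∃ z ∈ integerLattice n,
      x + v = ((i : ℝ) / 2 + ε) • t + z := by
  obtain ⟨φ, hφ⟩ := exists_equiv_mapLattice hπ
  let ψ : (Fin n → ℝ) →ₗ[ℝ] (Fin i → ℝ) := φ.toLinearMap ∘ₗ π
  have hψ : Function.Surjective ψ := φ.surjective.comp hπ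
  have hψo : IsOpenMap ψ := LinearMap.isOpenMap_of_finiteDimensional ψ hψ
  let P := convexHull ℝ (ψ '' S)
  have hP : ψ '' convexHull ℝ S = P := LinearMap.image_convexHull ψ S
  have h0P : (0 : Fin i → ℝ) ∈ interior P := by
    rw [← hP]
    exact hψo.image_interior_subset _ ⟨0, h0, map_zero _⟩
  have hPl : IsLatticePolytope P := by
    refine ⟨affineSpan_eq_top_of_nonempty_interior ⟨0, ?_⟩, ψ '' S, hS.image _, ?_, rfl⟩
    · rwa [(convex_convexHull ℝ _).convexHull_eq]
    · rintro _ ⟨s, hs, rfl⟩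
      exact (hφ _).1 ⟨s, hSZ hs, rfl⟩
  have hPh : ¬ IsHollow P (integerLattice i) := fun h =>
    Set.eq_empty_iff_forall_notMem.1 h 0 ⟨h0P, zero_mem_integerLattice i⟩
  have hlt : coveringRadius P (integerLattice i) < (i : ℝ) / 2 + ε :=
    (H P hPl hPh).trans_lt (by linarith)
  obtain ⟨μ, ⟨hμ0, hμ⟩, hμlt⟩ := exists_lt_of_csInf_lt
    (exists_smul_add_integerLattice_eq_univ h0P) hlt
  have hx : ψ x ∈ μ • P + integerLattice i := hμ ▸ Set.mem_univ _
  obtain ⟨_, ⟨p, hp, rfl⟩, y, hy, hxy⟩ := hx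
  rw [← hP] at hp
  obtain ⟨t, ht, rfl⟩ := hp
  obtain ⟨z, hz, hzy⟩ := (hφ (φ.symm y)).2 (by simpa using hy)
  obtain ⟨s, hs, hst⟩ := smul_mem_of_zero_mem (convex_convexHull ℝ S) (interior_subset h0) hμ0
    hμlt.le ht
  refine ⟨μ • t + z - x, ?_, s, hs, z, hz, ?_⟩
  · rw [LinearMap.mem_ker]
    apply φ.injective
    have h1 : φ (π z) = y := by rw [hzy]; simp
    have h2 : μ • φ (π t) + y = φ (π x) := hxy
    rw [map_sub, map_add, map_smul, map_sub, map_add, map_smul, h1, h2, sub_self, map_zero]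
  · rw [← hst]
    abel

/-- The bound on covering radii of non-hollow lattice polytopes bounds the covering minima of every
lattice polytope `K` with the origin in its interior. Projecting along `V` reduces to the covering
radius of the image of `K` when `ℤⁿ` projects to a lattice. Otherwise `ℤⁿ` has a vector whose
projection is short, and adding it to `V` lowers the codimension. -/
theorem meetsFlats_of_coveringRadius_le {d : ℕ}
    (H : ∀ i : ℕ, 1 ≤ i → i ≤ d → ∀ P : Set (Fin i → ℝ), IsLatticePolytope P →
        ¬ IsHollow P (integerLattice i) → coveringRadius P (integerLattice i) ≤ (i : ℝ) / 2)
    {n : ℕ} {S : Set (Fin n → ℝ)} (hS : S.Finite) (hSZ : S ⊆ integerLattice n)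
    (h0 : (0 : Fin n → ℝ) ∈ interior (convexHull ℝ S)) (i : ℕ) (hi : i ≤ d) :
    ∀ ε : ℝ, 0 < ε → MeetsFlats i ((i : ℝ) / 2 + ε) (convexHull ℝ S) := by
  have h0' := interior_subset h0
  have hconv := convex_convexHull ℝ S
  induction i with
  | zero =>
    intro ε hε V hV x
    have hVt : V = ⊤ := Submodule.eq_top_of_finrank_eq (by simpa using hV)
    exact ⟨-x, hVt ▸ Submodule.mem_top, 0, h0', 0, zero_mem_integerLattice n, by simp⟩
  | succ i ih =>
    intro ε hε V hV x
    obtain ⟨π, hπ, hker⟩ := exists_surjective_ker_eq V hV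
    by_cases hd : DiscreteTopology (mapLattice π)
    · rw [← hker]
      exact meets_of_discrete (H _ (by omega) hi) hS hSZ h0 hπ hε x
    · have hπo : IsOpenMap π := LinearMap.isOpenMap_of_finiteDimensional π hπ
      have hnhds : (ε / 2) • (π '' convexHull ℝ S) ∈ nhds (0 : Fin (i + 1) → ℝ) := by
        rw [set_smul_mem_nhds_zero_iff (by positivity), ← mem_interior_iff_mem_nhds]
        exact hπo.image_interior_subset _ ⟨0, h0, map_zero _⟩
      obtain ⟨δ, hδ, hball⟩ := Metric.mem_nhds_iff.1 hnhds
      obtain ⟨w, hw, hw0, hwδ⟩ := exists_short_of_not_discrete hd hδ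
      have hwV : w ∉ V := by rwa [← hker, LinearMap.mem_ker]
      have hV' : Module.finrank ℝ (V ⊔ Submodule.span ℝ {w} : Submodule ℝ (Fin n → ℝ)) + i = n := by
        have h1 := Submodule.finrank_sup_add_finrank_inf_eq V (Submodule.span ℝ {w})
        have h2 : V ⊓ Submodule.span ℝ {w} = ⊥ := by
          rw [← disjoint_iff, Submodule.disjoint_span_singleton' (by rintro rfl; simp at hw0)]
          exact hwV
        rw [h2, finrank_bot, finrank_span_singleton (by rintro rfl; simp at hw0)] at h1
        omega
      obtain ⟨v', hv', t, ht, z, hz, hvt⟩ := ih (by omega) (ε / 2) (by positivity) _ hV' x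
      obtain ⟨v, hv, _, hvw, rfl⟩ := Submodule.mem_sup.1 hv'
      obtain ⟨a, rfl⟩ := Submodule.mem_span_singleton.1 hvw
      -- The integer part of `a` is absorbed by the lattice, the fractional part by `(ε / 2) K`.
      have hfr : π (-(Int.fract a) • w) ∈ (ε / 2) • (π '' convexHull ℝ S) := by
        apply hball
        rw [mem_ball_zero_iff, map_smul, norm_smul, norm_neg,
          Real.norm_of_nonneg (Int.fract_nonneg a)]
        nlinarith [Int.fract_lt_one a, Int.fract_nonneg a, norm_nonneg (π w)]
      obtain ⟨_, ⟨t', ht', rfl⟩, htw⟩ := hfr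
      obtain ⟨r, hr, hrt⟩ := add_smul_mem hconv (a := (i : ℝ) / 2 + ε / 2) (b := ε / 2)
        (by positivity) (by positivity) ht ht'
      obtain ⟨s, hs, hsr⟩ := smul_mem_of_zero_mem hconv h0'
        (a := (i : ℝ) / 2 + ε / 2 + ε / 2) (b := ((i + 1 : ℕ) : ℝ) / 2 + ε) (by positivity)
        (by push_cast; linarith) hr
      refine ⟨v + (Int.fract a • w + (ε / 2) • t'), ?_, s, hs, z - (⌊a⌋ : ℝ) • w,
        sub_mem_integerLattice hz (zsmul_mem_integerLattice _ hw), ?_⟩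
      · refine add_mem hv ?_
        rw [← hker, LinearMap.mem_ker, map_add, map_smul π (ε / 2)]
        have : (ε / 2) • π t' = π (-(Int.fract a) • w) := htw
        rw [this, ← map_add, neg_smul, add_neg_cancel, map_zero]
      · rw [← hsr, ← hrt]
        have h1 : Int.fract a • w = a • w - (⌊a⌋ : ℝ) • w := by
          rw [← sub_smul, Int.self_sub_floor]
        rw [h1]
        have h2 : x + (v + (a • w - (⌊a⌋ : ℝ) • w + (ε / 2) • t'))
          = (x + (v + a • w)) + ((ε / 2) • t' - (⌊a⌋ : ℝ) • w) := by abel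
        rw [h2, hvt]
        abel

/-! ### The standard terminal simplex -/

/-- The vertices `-𝟙, e₁, …, eₙ` of the standard terminal simplex. -/
def terminalVertices (n : ℕ) : Set (Fin n → ℝ) :=
  insert (fun _ => -1) (Set.range fun j : Fin n => Pi.single j 1)

theorem finite_terminalVertices (n : ℕ) : (terminalVertices n).Finite :=
  (Set.finite_range _).insert _

theorem terminalVertices_subset (n : ℕ) : terminalVertices n ⊆ integerLattice n := by
  rintro _ (rfl | ⟨j, rfl⟩)
  · exact ⟨fun _ => -1, by simp⟩
  · exact single_mem_integerLattice j

theorem convex_terminalSimplex (n : ℕ) : Convex ℝ (terminalSimplex n) := convex_convexHull ℝ _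

theorem zero_mem_interior_terminalSimplex (n : ℕ) :
    (0 : Fin n → ℝ) ∈ interior (terminalSimplex n) := by
  -- `w = ∑ (wⱼ + a) eⱼ + a (-𝟙)` has coefficients of sum `1` for `a = (1 - ∑ wⱼ) / (n + 1)`.
  let a : (Fin n → ℝ) → ℝ := fun w => (1 - ∑ j, w j) / (n + 1)
  have ha : Continuous a := by fun_prop
  let U : Set (Fin n → ℝ) := {w | 0 < a w} ∩ ⋂ j : Fin n, {w | 0 < w j + a w}
  have hU : IsOpen U := by
    refine (isOpen_lt continuous_const ha).inter (isOpen_iInter_of_finite fun j => ?_)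
    exact isOpen_lt continuous_const ((continuous_apply j).add ha)
  refine mem_interior.2 ⟨U, ?_, hU, ?_⟩
  · rintro w ⟨hw0, hw⟩
    have hw' : ∀ j, 0 < w j + a w := fun j => Set.mem_iInter.1 hw j
    have hmem := (convex_terminalSimplex n).sum_mem (t := (Finset.univ : Finset (Option (Fin n))))
      (w := fun o => o.elim (a w) fun j => w j + a w)
      (z := fun o => o.elim (fun _ => -1) fun j => Pi.single j 1) ?_ ?_ ?_
    · convert hmem using 1
      ext b
      simp [Fintype.sum_option, Finset.sum_apply, Pi.single_apply]
    · rintro (_ | j) -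
      · exact le_of_lt hw0
      · exact (hw' j).le
    · simp only [Fintype.sum_option, Option.elim, Finset.sum_add_distrib, Finset.sum_const,
        Finset.card_univ, Fintype.card_fin, nsmul_eq_mul]
      have : ((n : ℝ) + 1) ≠ 0 := by positivity
      simp only [a]
      field_simp
      ring
    · rintro (_ | j) -
      · exact subset_convexHull ℝ _ (Set.mem_insert _ _)
      · exact subset_convexHull ℝ _ (Set.mem_insert_of_mem _ ⟨j, rfl⟩)
  · have h : 0 < a 0 := by
      simp only [a, Pi.zero_apply, Finset.sum_const_zero, sub_zero]
      positivity
    exact ⟨h, Set.mem_iInter.2 fun j => by simpa using h⟩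

/-- Valid inequalities for `Tₙ`. For `J` the set of all coordinates these are its facets. -/
theorem sum_sub_le_of_mem_terminalSimplex {n : ℕ} {w : Fin n → ℝ} (hw : w ∈ terminalSimplex n)
    (J : Finset (Fin n)) :
    ∑ b ∈ J, w b ≤ 1 ∧ ∀ k ∈ J, ∑ b ∈ J, w b - (J.card + 1) * w k ≤ 1 := by
  have hlin : ∀ f : (Fin n → ℝ) →ₗ[ℝ] ℝ, f (fun _ => -1) ≤ 1 → (∀ j, f (Pi.single j 1) ≤ 1) →
      f w ≤ 1 := by
    intro f h1 h2
    refine convexHull_min ?_ (convex_halfSpace_le f.isLinear 1) hw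
    rintro _ (rfl | ⟨j, rfl⟩)
    · exact h1
    · exact h2 j
  have hsingle : ∀ j : Fin n, ∑ b ∈ J, (Pi.single j 1 : Fin n → ℝ) b ≤ 1 := by
    intro j
    simp only [Pi.single_apply, Finset.sum_ite_eq']
    split_ifs <;> norm_num
  constructor
  · have := hlin (∑ b ∈ J, LinearMap.proj b) ?_ ?_
    · simpa using this
    · simp only [LinearMap.sum_apply, LinearMap.proj_apply, Finset.sum_const, nsmul_eq_mul]
      have : (0 : ℝ) ≤ J.card := by positivity
      linarith
    · intro j
      simpa using hsingle j
  · intro k hk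
    have := hlin (∑ b ∈ J, LinearMap.proj b - ((J.card : ℝ) + 1) • LinearMap.proj k) ?_ ?_
    · simpa using this
    · simp
    · intro j
      have h1 := hsingle j
      have h2 : 0 ≤ ((J.card : ℝ) + 1) * (Pi.single j 1 : Fin n → ℝ) k := by
        rw [Pi.single_apply]
        split_ifs <;> positivity
      simp only [LinearMap.sub_apply, LinearMap.sum_apply, LinearMap.proj_apply,
        LinearMap.smul_apply, smul_eq_mul]
      linarith

/-- The sum of `N` distinct nonnegative integers is at least `0 + 1 + ⋯ + (N - 1)`. -/
theorem card_mul_le_two_mul_sum {ι : Type*} (s : Finset ι) (f : ι → ℤ)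
    (hf : Set.InjOn f s) (h0 : ∀ b ∈ s, 0 ≤ f b) :
    (s.card : ℤ) * (s.card - 1) ≤ 2 * ∑ b ∈ s, f b := by
  classical
  have h := Finset.sum_range_le_sum (s := s.image f) (c := 0) (by simpa using h0)
  rw [Finset.sum_image hf, Finset.card_image_of_injOn hf] at h
  have h2 : ∀ N : ℕ, 2 * ∑ n ∈ Finset.range N, ((0 : ℤ) + n) = N * (N - 1) := by
    intro N
    induction N with
    | zero => simp
    | succ N ih =>
      rw [Finset.sum_range_succ, mul_add, ih]
      push_cast
      ring
  rw [← h2]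
  linarith

/-- If `N` reals represent distinct classes in `(1/N)ℤ / ℤ`, then the `N` multiples
`N (y b - min y)` are distinct nonnegative integers, which bounds the sum of the `y b - min y`. -/
theorem exists_sum_sub_ge {ι : Type*} [Fintype ι] [Nonempty ι] (y : ι → ℝ) (r : ι → ℕ)
    (hr : Function.Injective r) (hlt : ∀ b, r b < Fintype.card ι)
    (hy : ∀ b, ∃ z : ℤ, y b = r b / (Fintype.card ι : ℝ) + z) :
    ∃ k, ((Fintype.card ι : ℝ) - 1) / 2 ≤ ∑ b, (y b - y k) := by
  obtain ⟨k, hk⟩ := Finite.exists_min y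
  choose z hz using hy
  have hN : (0 : ℝ) < Fintype.card ι := by exact_mod_cast Fintype.card_pos
  let f : ι → ℤ := fun b => r b - r k + Fintype.card ι * (z b - z k)
  have hf : ∀ b, (f b : ℝ) = Fintype.card ι * (y b - y k) := by
    intro b
    rw [hz b, hz k]
    simp only [f]
    push_cast
    field_simp
    ring
  have hinj : Set.InjOn f (Finset.univ : Finset ι) := by
    intro a _ b _ hab
    apply hr
    have h1 : ((r a : ℤ)) ≡ r b [ZMOD Fintype.card ι] := by
      refine (Int.modEq_iff_dvd.2 ⟨z a - z b, ?_⟩)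
      simp only [f] at hab
      linear_combination -hab
    have h2 := (Int.natCast_modEq_iff.1 h1)
    exact Nat.ModEq.eq_of_lt_of_lt h2 (hlt a) (hlt b)
  have hnn : ∀ b ∈ (Finset.univ : Finset ι), 0 ≤ f b := by
    intro b _
    have : (0 : ℝ) ≤ f b := by
      rw [hf]
      exact mul_nonneg hN.le (sub_nonneg.2 (hk b))
    exact_mod_cast this
  have h := card_mul_le_two_mul_sum Finset.univ f hinj hnn
  refine ⟨k, ?_⟩
  have h' : ((Fintype.card ι : ℝ)) * (Fintype.card ι - 1) ≤ 2 * ∑ b, (f b : ℝ) := by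
    exact_mod_cast h
  simp only [hf] at h'
  rw [← Finset.mul_sum] at h'
  have := le_of_mul_le_mul_left (a := (Fintype.card ι : ℝ)) (by linarith :
    (Fintype.card ι : ℝ) * (Fintype.card ι - 1) ≤ Fintype.card ι * (2 * ∑ b, (y b - y k))) hN
  linarith

/-- A point whose coordinates in `J` are `1/(m+1), …, m/(m+1)` modulo `1`, where `m = |J|`, is a
deep hole for the image of `Tₙ` under the projection to these coordinates: no dilate by a factor
below `m / 2` reaches it modulo `ℤ`. -/
theorem half_card_le_of_deep_hole {n : ℕ} {w : Fin n → ℝ} (hw : w ∈ terminalSimplex n)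
    {c : ℝ} (hc : 0 ≤ c) (J : Finset (Fin n)) (r : Fin n → ℕ) (hr : Set.InjOn r J)
    (hr0 : ∀ b ∈ J, 0 < r b) (hrJ : ∀ b ∈ J, r b ≤ J.card)
    (hz : ∀ b ∈ J, ∃ z : ℤ, c * w b = r b / ((J.card : ℝ) + 1) + z) : (J.card : ℝ) / 2 ≤ c := by
  have hcard : Fintype.card (Option J) = J.card + 1 := by simp
  let y : Option J → ℝ := fun o => o.elim 0 fun b => c * w b
  have hinj : Function.Injective (fun o : Option J => o.elim 0 fun b => r b) := by
    rintro (_ | a) (_ | b) hab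
    · rfl
    · exact absurd hab (hr0 b b.2).ne
    · exact absurd hab (hr0 a a.2).ne'
    · exact congrArg some (Subtype.ext (hr a.2 b.2 hab))
  obtain ⟨k, hk⟩ := exists_sum_sub_ge y _ hinj
    (by
      rintro (_ | b)
      · rw [hcard]; exact Nat.succ_pos _
      · rw [hcard]; exact Nat.lt_succ_of_le (hrJ b b.2))
    (by
      rintro (_ | b)
      · exact ⟨0, by simp [y]⟩
      · rw [hcard]
        simpa [y] using hz b b.2)
  rw [hcard] at hk
  obtain ⟨h0, h1⟩ := sum_sub_le_of_mem_terminalSimplex hw J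
  have hle : ∑ b : Option J, (y b - y k) ≤ c := by
    rw [Finset.sum_sub_distrib, Fintype.sum_option, Finset.sum_const, Finset.card_univ, hcard]
    simp only [y, Option.elim, zero_add, nsmul_eq_mul]
    rw [← Finset.mul_sum, Finset.sum_coe_sort J w]
    push_cast
    rcases k with _ | k
    · simpa using mul_le_mul_of_nonneg_left h0 hc
    · have := mul_le_mul_of_nonneg_left (h1 k k.2) hc
      simp only
      linarith
  refine le_trans (le_of_eq ?_) (hk.trans hle)
  push_cast
  rw [add_sub_cancel_right]

/-- Distinct labels `1, …, |J|` for the elements of a finite set `J`. -/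
theorem exists_labelling {α : Type*} (J : Finset α) :
    ∃ r : α → ℕ, Set.InjOn r J ∧ (∀ b ∈ J, 0 < r b) ∧ ∀ b ∈ J, r b ≤ J.card := by
  classical
  refine ⟨fun b => if h : b ∈ J then (J.equivFin ⟨b, h⟩ : ℕ) + 1 else 0, ?_, ?_, ?_⟩
  · intro a ha b hb hab
    have ha' : a ∈ J := ha
    have hb' : b ∈ J := hb
    simp only [ha', hb', dif_pos, add_left_inj] at hab
    simpa using J.equivFin.injective (Fin.ext hab)
  · intro b hb
    simp [hb]
  · intro b hb
    simp only [hb, dif_pos]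
    exact (J.equivFin ⟨b, hb⟩).2

/-! ### Splitting coordinates into blocks -/

section Blocks

variable {n k : ℕ} {l : Fin k → ℕ} (e : (Σ j : Fin k, Fin (l j)) ≃ Fin n)

/-- The projection of `ℝⁿ` onto its `j`-th block of coordinates. -/
def blockProj (j : Fin k) : (Fin n → ℝ) →ₗ[ℝ] (Fin (l j) → ℝ) :=
  LinearMap.funLeft ℝ ℝ fun b => e ⟨j, b⟩

theorem blockProj_apply (j : Fin k) (y : Fin n → ℝ) (b : Fin (l j)) :
    blockProj e j y b = y (e ⟨j, b⟩) := rfl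

theorem sum_blockInclusion_apply (x : ∀ j, Fin (l j) → ℝ) (j : Fin k) (b : Fin (l j)) :
    (∑ j', blockInclusion e j' (x j')) (e ⟨j, b⟩) = x j b := by
  rw [Finset.sum_apply, Finset.sum_eq_single j]
  · unfold blockInclusion
    rw [Equiv.symm_apply_apply, Pi.single_eq_same]
  · intro j' _ hj
    unfold blockInclusion
    rw [Equiv.symm_apply_apply, Pi.single_eq_of_ne hj.symm, Pi.zero_apply]
  · simp

theorem blockInclusion_smul (j : Fin k) (c : ℝ) (x : Fin (l j) → ℝ) :
    blockInclusion e j (c • x) = c • blockInclusion e j x := by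
  ext a
  simp [blockInclusion, Pi.single_smul]

/-- The vectors of `ℝⁿ` that vanish on the blocks in `s`. -/
def vanishing (s : Finset (Fin k)) : Submodule ℝ (Fin n → ℝ) :=
  ⨅ j ∈ s, LinearMap.ker (blockProj e j)

theorem vanishing_insert (j : Fin k) (s : Finset (Fin k)) :
    vanishing e (insert j s) = LinearMap.ker (blockProj e j) ⊓ vanishing e s := by
  ext y
  simp only [vanishing, Submodule.mem_iInf, Finset.forall_mem_insert, Submodule.mem_inf]

theorem vanishing_empty : vanishing e ∅ = ⊤ := by
  ext y
  simp only [vanishing, Submodule.mem_iInf, Finset.notMem_empty, false_imp_iff, implies_true,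
    Submodule.mem_top]

theorem vanishing_univ : vanishing e Finset.univ = ⊥ := by
  rw [eq_bot_iff]
  intro y hy
  simp only [vanishing, Finset.mem_univ, iInf_pos, Submodule.mem_iInf, LinearMap.mem_ker] at hy
  rw [Submodule.mem_bot]
  ext a
  obtain ⟨⟨j, b⟩, rfl⟩ := e.surjective a
  exact congrFun (hy j) b

theorem sum_block_sizes (e : (Σ j : Fin k, Fin (l j)) ≃ Fin n) : ∑ j, l j = n := by
  have := Fintype.card_congr e
  simpa using this

theorem finrank_map_add_finrank_inf_ker {E F : Type*} [AddCommGroup E] [Module ℝ E]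
    [FiniteDimensional ℝ E] [AddCommGroup F] [Module ℝ F] (f : E →ₗ[ℝ] F) (V : Submodule ℝ E) :
    Module.finrank ℝ (V.map f) + Module.finrank ℝ (V ⊓ LinearMap.ker f : Submodule ℝ E)
      = Module.finrank ℝ V := by
  have h := LinearMap.finrank_range_add_finrank_ker (f ∘ₗ V.subtype)
  rw [LinearMap.range_comp, Submodule.range_subtype, LinearMap.ker_comp] at h
  rw [← h, ← Submodule.map_comap_subtype, Submodule.finrank_map_subtype_eq]

/-- Flats are met block by block. For `V` of codimension `i`, the codimensions `iⱼ` of the images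
in block `j` of the successive intersections of `V` with the kernels of the previous block
projections add up to `i`, and the bounds `iⱼ / 2 + ε` for the blocks add up accordingly. The first
conjunct says that the codimension of the image of `V` in the blocks `s` is not negative. -/
theorem exists_meets_blocks {d : ℕ} {K : ∀ j, Set (Fin (l j) → ℝ)} {ε : ℝ} (hε : 0 < ε)
    (hK : ∀ j, ∀ i ≤ d, MeetsFlats i ((i : ℝ) / 2 + ε) (K j)) (s : Finset (Fin k)) :
    ∀ V : Submodule ℝ (Fin n → ℝ),
      Module.finrank ℝ V
        ≤ Module.finrank ℝ (V ⊓ vanishing e s : Submodule ℝ (Fin n → ℝ)) + ∑ j ∈ s, l j ∧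
      ∀ i ≤ d, Module.finrank ℝ V + i
          = Module.finrank ℝ (V ⊓ vanishing e s : Submodule ℝ (Fin n → ℝ)) + ∑ j ∈ s, l j →
        ∀ x, ∃ v ∈ V, ∃ c : Fin k → ℝ, ∑ j ∈ s, c j = (i : ℝ) / 2 + s.card * ε ∧
          ∀ j ∈ s, 0 ≤ c j ∧ ∃ t ∈ K j, ∃ z ∈ integerLattice (l j),
            blockProj e j (x + v) = c j • t + z := by
  classical
  induction s using Finset.induction_on with
  | empty =>
    intro V
    rw [vanishing_empty, inf_top_eq]
    refine ⟨by simp, fun i _ hV x => ⟨0, V.zero_mem, 0, ?_, by simp⟩⟩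
    have : i = 0 := by simpa using hV
    simp [this]
  | insert j s hj ih =>
    intro V
    have h1 := finrank_map_add_finrank_inf_ker (blockProj e j) V
    have h2 : Module.finrank ℝ (V.map (blockProj e j)) ≤ l j :=
      (Submodule.finrank_le _).trans_eq (Module.finrank_fin_fun ℝ)
    obtain ⟨h3, h4⟩ := ih (V ⊓ LinearMap.ker (blockProj e j))
    rw [vanishing_insert, Finset.sum_insert hj, ← inf_assoc]
    refine ⟨by omega, fun i hi hV x => ?_⟩
    obtain ⟨i₁, hi₁⟩ := Nat.exists_eq_add_of_le h2
    obtain ⟨i₂, rfl⟩ : ∃ i₂, i = i₁ + i₂ := Nat.exists_eq_add_of_le (by omega)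
    obtain ⟨_, ⟨v₁, hv₁, rfl⟩, t, ht, z, hz, h⟩ :=
      hK j i₁ (by omega) (V.map (blockProj e j)) (by omega) (blockProj e j x)
    obtain ⟨v₂, ⟨hv₂, hv₂j⟩, c, hc, hcs⟩ := h4 i₂ (by omega) (by omega) (x + v₁)
    refine ⟨v₁ + v₂, add_mem hv₁ hv₂, Function.update c j ((i₁ : ℝ) / 2 + ε), ?_, ?_⟩
    · rw [Finset.sum_insert hj, Function.update_self, Finset.sum_update_of_notMem hj, hc,
        Finset.card_insert_of_notMem hj]
      push_cast
      ring
    · intro j' hj'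
      rcases Finset.mem_insert.1 hj' with rfl | hj's
      · rw [Function.update_self]
        refine ⟨by positivity, t, ht, z, hz, ?_⟩
        rw [← h, ← add_assoc, map_add, map_add, LinearMap.mem_ker.1 hv₂j, add_zero]
      · rw [Function.update_of_ne (by rintro rfl; exact hj hj's), ← add_assoc]
        exact hcs j' hj's

theorem MeetsFlats.translate {m i : ℕ} {μ : ℝ} {K : Set (Fin m → ℝ)} (h : MeetsFlats i μ K)
    (u : Fin m → ℝ) : MeetsFlats i μ ((fun x => u + x) '' K) := by
  intro V hV x
  obtain ⟨v, hv, t, ht, z, hz, hvt⟩ := h V hV (x - μ • u)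
  refine ⟨v, hv, _, ⟨t, ht, rfl⟩, z, hz, ?_⟩
  have : x + v = (x - μ • u + v) + μ • u := by abel
  rw [this, hvt, smul_add]
  abel

/-- Bounds of the form `i / 2` on the covering minima of the summands pass to direct sums. -/
theorem meetsFlats_convexDirectSum {d : ℕ} {K : ∀ j, Set (Fin (l j) → ℝ)}
    (hK : ∀ j, ∀ i ≤ d, ∀ ε : ℝ, 0 < ε → MeetsFlats i ((i : ℝ) / 2 + ε) (K j)) {i : ℕ}
    (hi0 : 1 ≤ i) (hi : i ≤ d) {ε : ℝ} (hε : 0 < ε) :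
    MeetsFlats i ((i : ℝ) / 2 + ε) (convexDirectSum fun j => blockInclusion e j '' K j) := by
  intro V hV x
  have hk : 0 < k := (Nat.zero_le _).trans_lt (e.symm ⟨0, by omega⟩).1.2
  have hk' : (0 : ℝ) < k := by exact_mod_cast hk
  obtain ⟨v, hv, c, hc, hcs⟩ := (exists_meets_blocks e (d := d) (K := K) (ε := ε / k)
    (by positivity) (fun j i hi => hK j i hi _ (by positivity)) Finset.univ V).2 i hi
    (by rw [vanishing_univ, inf_bot_eq, finrank_bot, sum_block_sizes e]; omega) x
  choose hc0 t ht z hz h using fun j => hcs j (Finset.mem_univ j)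
  have hsum : ∑ j, c j = (i : ℝ) / 2 + ε := by
    rw [hc, Finset.card_univ, Fintype.card_fin, mul_div_cancel₀ _ hk'.ne']
  set μ : ℝ := (i : ℝ) / 2 + ε
  have hμ : 0 < μ := by positivity
  refine ⟨v, hv, ∑ j, (c j / μ) • blockInclusion e j (t j), ?_,
    ∑ j, blockInclusion e j (z j), ?_, ?_⟩
  · refine ⟨fun j => c j / μ, ⟨fun j => div_nonneg (hc0 j) hμ.le, ?_⟩,
      fun j => blockInclusion e j (t j), fun j => ⟨t j, ht j, rfl⟩, rfl⟩
    rw [← Finset.sum_div, hsum, div_self hμ.ne']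
  · rw [mem_integerLattice]
    intro a
    obtain ⟨⟨j, b⟩, rfl⟩ := e.surjective a
    rw [sum_blockInclusion_apply]
    exact mem_integerLattice.1 (hz j) b
  · ext a
    obtain ⟨⟨j, b⟩, rfl⟩ := e.surjective a
    have := congrFun (h j) b
    simp only [← blockInclusion_smul]
    rw [Pi.add_apply (μ • _), Pi.smul_apply, sum_blockInclusion_apply, sum_blockInclusion_apply,
      ← blockProj_apply e j (x + v), this, Pi.add_apply, smul_eq_mul, Pi.smul_apply, Pi.smul_apply, smul_eq_mul,
      smul_eq_mul, ← mul_assoc, mul_div_cancel₀ _ hμ.ne']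

/-- A direct sum of translated standard terminal simplices has covering minima at least `i / 2`.
The flat to look at prescribes `i` coordinates, as the coordinates of a deep hole in each block. A
point of `μ T` that meets it uses some block at a scale of at most `m μ / i`, for `m` the number of
coordinates prescribed in that block. The block contains the origin, so it can be taken to be used
at exactly this scale, and the holes are shifted by `uⱼ` at this scale beforehand. -/
theorem half_le_of_meetsFlats {u : ∀ j, Fin (l j) → ℝ}
    (hu : ∀ j, (0 : Fin (l j) → ℝ) ∈ (fun x => u j + x) '' terminalSimplex (l j)) {i : ℕ}
    (hi0 : 1 ≤ i) (hi : i ≤ n) {μ : ℝ} (hμ0 : 0 ≤ μ)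
    (hμ : MeetsFlats i μ (convexDirectSum fun j =>
      blockInclusion e j '' ((fun x => u j + x) '' terminalSimplex (l j)))) : (i : ℝ) / 2 ≤ μ := by
  classical
  have hi' : (0 : ℝ) < i := by exact_mod_cast hi0
  obtain ⟨I, -, hI⟩ := Finset.exists_subset_card_eq (s := (Finset.univ : Finset (Fin n))) (n := i)
    (by simpa using hi)
  let J : ∀ j, Finset (Fin (l j)) := fun j => Finset.univ.filter fun b => e ⟨j, b⟩ ∈ I
  have hJ : ∑ j, (J j).card = i := by
    rw [← hI, ← Finset.card_sigma]
    refine Finset.card_bij (fun a _ => e a) ?_ (fun a _ b _ h => e.injective h) ?_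
    · rintro ⟨j, b⟩ hb
      simpa [J] using hb
    · intro a ha
      exact ⟨e.symm a, by simpa [J] using ha, by simp⟩
  choose r hr hr0 hrJ using fun j => exists_labelling (J j)
  let π := LinearMap.funLeft ℝ ℝ (Subtype.val : I → Fin n)
  have hπ : Function.Surjective π :=
    LinearMap.funLeft_surjective_of_injective ℝ ℝ _ Subtype.val_injective
  have hV : Module.finrank ℝ (LinearMap.ker π) + i = n := by
    have := LinearMap.finrank_range_add_finrank_ker π
    rw [LinearMap.range_eq_top.2 hπ, finrank_top, Module.finrank_fintype_fun_eq_card,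
      Module.finrank_fin_fun, Fintype.card_coe, hI] at this
    omega
  let γ : Fin k → ℝ := fun j => μ / i * (J j).card
  obtain ⟨v, hv, _, ⟨c, ⟨hc0, hc1⟩, p, hp, rfl⟩, z, hz, h⟩ := hμ _ hV
    (∑ j, blockInclusion e j (γ j • u j + fun b => (r j b : ℝ) / ((J j).card + 1)))
  choose q hq hqp using hp
  obtain ⟨j, hj0, hj⟩ : ∃ j, 0 < (J j).card ∧ μ * c j ≤ γ j := by
    by_contra! hc
    have hle : ∀ j, γ j ≤ μ * c j := by
      intro j
      rcases Nat.eq_zero_or_pos (J j).card with h0 | h0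
      · simpa [γ, h0] using mul_nonneg hμ0 (hc0 j)
      · exact (hc j h0).le
    obtain ⟨j, -, hj⟩ : ∃ j ∈ Finset.univ, 0 < (J j).card := by
      by_contra! h0
      have : ∑ j, (J j).card = 0 := Finset.sum_eq_zero fun j hj => Nat.le_zero.1 (h0 j hj)
      omega
    have hlt : ∑ j, γ j < ∑ j, μ * c j :=
      Finset.sum_lt_sum (fun j _ => hle j) ⟨j, Finset.mem_univ j, hc j hj⟩
    rw [← Finset.mul_sum, ← Finset.mul_sum, hc1, ← Nat.cast_sum, hJ, div_mul_cancel₀ _ hi'.ne',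
      mul_one] at hlt
    exact lt_irrefl _ hlt
  have hKc : Convex ℝ ((fun x => u j + x) '' terminalSimplex (l j)) :=
    (convex_terminalSimplex _).translate _
  obtain ⟨_, ⟨w, hw, rfl⟩, hw'⟩ := smul_mem_of_zero_mem hKc (hu j) (mul_nonneg hμ0 (hc0 j)) hj (hq j)
  have hhole : ((J j).card : ℝ) / 2 ≤ γ j := by
    refine half_card_le_of_deep_hole hw (by positivity) (J j) (r j) (hr j) (hr0 j) (hrJ j) ?_
    intro b hb
    have hbI : e ⟨j, b⟩ ∈ I := by simpa [J] using hb
    have h1 := congrFun h (e ⟨j, b⟩)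
    have h2 : v (e ⟨j, b⟩) = 0 := congrFun (LinearMap.mem_ker.1 hv) ⟨_, hbI⟩
    obtain ⟨m, hm⟩ := mem_integerLattice.1 hz (e ⟨j, b⟩)
    simp only [← hqp, ← blockInclusion_smul] at h1
    rw [Pi.add_apply, Pi.add_apply, Pi.smul_apply, sum_blockInclusion_apply,
      sum_blockInclusion_apply, h2, hm] at h1
    have h3 := congrFun hw' b
    simp only [Pi.add_apply, Pi.smul_apply, smul_eq_mul] at h1 h3
    refine ⟨-m, ?_⟩
    push_cast
    linarith
  have hj' : (0 : ℝ) < (J j).card := by exact_mod_cast hj0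
  have : (1 : ℝ) / 2 ≤ μ / i := by
    refine le_of_mul_le_mul_right ?_ hj'
    calc (1 : ℝ) / 2 * (J j).card = (J j).card / 2 := by ring
      _ ≤ _ := hhole
  rw [le_div_iff₀ hi'] at this
  linarith

end Blocks

theorem terminalSimplex_isLatticePolytope (n : ℕ) : IsLatticePolytope (terminalSimplex n) :=
  ⟨affineSpan_eq_top_of_nonempty_interior
      ⟨0, by
        rw [(convex_terminalSimplex n).convexHull_eq]
        exact zero_mem_interior_terminalSimplex n⟩,
    terminalVertices n, finite_terminalVertices n, terminalVertices_subset n, rfl⟩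

theorem terminalSimplex_isTerminalPolytope {n : ℕ} (hn : 0 < n) :
    IsTerminalPolytope (terminalSimplex n) := by
  refine ⟨terminalSimplex_isLatticePolytope n, 1, fun _ => n, Equiv.uniqueSigma _, fun _ => 0,
    fun _ => hn, fun _ => ⟨0, interior_subset (zero_mem_interior_terminalSimplex n), by simp⟩, ?_⟩
  have hincl : ∀ x : Fin n → ℝ,
      blockInclusion (k := 1) (l := fun _ => n) (Equiv.uniqueSigma _) 0 x = x := by
    intro x
    ext a
    obtain ⟨⟨j, b⟩, rfl⟩ := (Equiv.uniqueSigma fun _ : Fin 1 => Fin n).surjective a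
    obtain rfl := Subsingleton.elim j 0
    simp only [blockInclusion, Equiv.symm_apply_apply]
    simp
    rfl
  ext y
  constructor
  · intro hy
    refine ⟨fun _ => 1, ⟨by simp, by simp⟩, fun _ => y, fun j => ?_, by simp⟩
    obtain rfl := Subsingleton.elim j 0
    exact ⟨y, ⟨y, hy, by simp⟩, hincl y⟩
  · rintro ⟨c, ⟨-, hc1⟩, x, hx, rfl⟩
    obtain ⟨_, ⟨y, hy, rfl⟩, h⟩ := hx 0
    rw [Fin.sum_univ_one] at hc1
    rw [Fin.sum_univ_one, hc1, one_smul, ← h, hincl]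
    simpa using hy

/-! ### Non-hollow lattice polytopes as projections of standard terminal simplices -/

/-- Simultaneous Diophantine approximation, by recurrence of `m ↦ (m xₛ mod 1)ₛ` in the unit cube. -/
theorem exists_simultaneous_approx {ι : Type*} [Fintype ι] (x : ι → ℝ) {δ : ℝ} (hδ : 0 < δ) :
    ∃ q : ℕ, 0 < q ∧ ∃ p : ι → ℤ, ∀ s, |q * x s - p s| < δ := by
  let f : ℕ → ι → ℝ := fun m s => Int.fract (m * x s)
  have hb : Bornology.IsBounded (Set.Icc (0 : ι → ℝ) 1) := Metric.isBounded_Icc 0 1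
  obtain ⟨a, -, φ, hφ, hlim⟩ := tendsto_subseq_of_bounded hb (x := f)
    fun m => ⟨fun s => Int.fract_nonneg _, fun s => (Int.fract_lt_one _).le⟩
  obtain ⟨N, hN⟩ := Metric.cauchySeq_iff'.1 hlim.cauchySeq δ hδ
  have hd := hN (N + 1) N.le_succ
  have hlt : φ N < φ (N + 1) := hφ N.lt_succ_self
  refine ⟨φ (N + 1) - φ N, Nat.sub_pos_of_lt hlt,
    fun s => ⌊(φ (N + 1) : ℝ) * x s⌋ - ⌊(φ N : ℝ) * x s⌋, fun s => ?_⟩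
  have h : |Int.fract ((φ (N + 1) : ℝ) * x s) - Int.fract ((φ N : ℝ) * x s)| < δ :=
    (dist_le_pi_dist _ _ s).trans_lt hd
  rw [Int.fract, Int.fract] at h
  convert h using 2
  rw [Nat.cast_sub hlt.le]
  push_cast
  ring

/-- If the origin is interior to the convex hull of finitely many points, then it is a combination
of them with all coefficients positive. -/
theorem exists_pos_relation {i : ℕ} {S : Set (Fin i → ℝ)} [Fintype S]
    (h0 : (0 : Fin i → ℝ) ∈ interior (convexHull ℝ S)) :
    ∃ a : S → ℝ, (∀ s, 0 < a s) ∧ ∑ s, a s • (s : Fin i → ℝ) = 0 := by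
  let m : Fin i → ℝ := ∑ s : S, (s : Fin i → ℝ)
  have hc : Continuous fun ε : ℝ => -(ε • m) := by fun_prop
  have hn : ∀ᶠ ε in nhds (0 : ℝ), -(ε • m) ∈ convexHull ℝ S :=
    hc.continuousAt.eventually_mem (by simpa using mem_interior_iff_mem_nhds.1 h0)
  obtain ⟨ε, hε, hε0⟩ := ((hn.filter_mono nhdsWithin_le_nhds).and
    (self_mem_nhdsWithin (s := Set.Ioi (0 : ℝ)))).exists
  rw [(Set.toFinite S).convexHull_eq_image] at hε
  obtain ⟨b, hb, hbm⟩ := hε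
  refine ⟨fun s => b s + ε, fun s => add_pos_of_nonneg_of_pos (hb.1 s) hε0, ?_⟩
  have hbm' : ∑ s : S, b s • (s : Fin i → ℝ) = -(ε • m) := by
    rw [← hbm]
    simp only [LinearMap.sum_apply, LinearMap.smulRight_apply, LinearMap.proj_apply]
    congr!
  simp only [add_smul, Finset.sum_add_distrib, hbm', m, Finset.smul_sum]
  simp

/-- For integral points the coefficients can be taken to be positive integers: a multiple of a real
relation with nearly integral coefficients can be rounded, since its integral value is close to
that of the exact relation, which is `0`. -/
theorem exists_pos_int_relation {i : ℕ} {S : Set (Fin i → ℝ)} [Fintype S]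
    (hSZ : S ⊆ integerLattice i) (h0 : (0 : Fin i → ℝ) ∈ interior (convexHull ℝ S)) :
    ∃ p : S → ℕ, (∀ s, 0 < p s) ∧ ∑ s, (p s : ℝ) • (s : Fin i → ℝ) = 0 := by
  obtain ⟨a, ha, hrel⟩ := exists_pos_relation h0
  have hS : Nonempty S := by
    obtain ⟨s, hs⟩ := convexHull_nonempty_iff.1 ⟨0, interior_subset h0⟩
    exact ⟨s, hs⟩
  obtain ⟨s₀, hs₀⟩ := Finite.exists_min a
  let C : ℝ := ∑ s : S, ‖(s : Fin i → ℝ)‖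
  have hC : 0 ≤ C := Finset.sum_nonneg fun s _ => norm_nonneg _
  obtain ⟨q, hq, p, hp⟩ := exists_simultaneous_approx a (δ := min (a s₀) (1 / (C + 1)))
    (lt_min (ha s₀) (by positivity))
  have hq1 : (1 : ℝ) ≤ q := by exact_mod_cast hq
  have hppos : ∀ s, 0 < p s := by
    intro s
    have h1 := (abs_lt.1 ((hp s).trans_le (min_le_left _ _))).2
    have h2 : a s ≤ q * a s := le_mul_of_one_le_left (ha s).le hq1
    have : (0 : ℝ) < p s := by linarith [hs₀ s]
    exact_mod_cast this
  have hzero : ∑ s, (p s : ℝ) • (s : Fin i → ℝ) = 0 := by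
    have h1 : ∑ s, (p s : ℝ) • (s : Fin i → ℝ) = ∑ s, ((p s : ℝ) - q * a s) • (s : Fin i → ℝ) := by
      simp only [sub_smul, Finset.sum_sub_distrib, mul_smul]
      rw [← Finset.smul_sum, hrel, smul_zero, sub_zero]
    have h2 : ‖∑ s, (p s : ℝ) • (s : Fin i → ℝ)‖ < 1 := by
      rw [h1]
      calc ‖∑ s, ((p s : ℝ) - q * a s) • (s : Fin i → ℝ)‖
          ≤ ∑ s : S, 1 / (C + 1) * ‖(s : Fin i → ℝ)‖ := by
            refine norm_sum_le_of_le _ fun s _ => ?_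
            rw [norm_smul, Real.norm_eq_abs, abs_sub_comm]
            exact mul_le_mul_of_nonneg_right ((hp s).le.trans (min_le_right _ _)) (norm_nonneg _)
        _ = C / (C + 1) := by rw [← Finset.mul_sum]; ring
        _ < 1 := by rw [div_lt_one (by positivity)]; linarith
    have h3 : ∑ s, (p s : ℝ) • (s : Fin i → ℝ) ∈ integerLattice i :=
      Finset.sum_induction _ (· ∈ integerLattice i) (fun _ _ => add_mem_integerLattice)
        (zero_mem_integerLattice i) fun s _ => zsmul_mem_integerLattice _ (hSZ s.2)
    obtain ⟨z, hz⟩ := h3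
    rw [← hz] at h2 ⊢
    ext j
    have h4 := (pi_norm_lt_iff one_pos).1 h2 j
    have h5 : |(z j : ℝ)| < 1 := h4
    have h6 : |z j| < 1 := by exact_mod_cast h5
    simp [Int.abs_lt_one_iff.1 h6]
  refine ⟨fun s => (p s).toNat, fun s => by simpa using hppos s, ?_⟩
  rw [← hzero]
  refine Finset.sum_congr rfl fun s _ => ?_
  congr 1
  exact_mod_cast Int.toNat_of_nonneg (hppos s).le

/-- A lattice polytope with the origin in its interior contains the image of a standard terminal
simplex of arbitrarily high dimension under an integral projection: in a relation between its
vertices with positive integer coefficients, repeat each vertex as often as its coefficient says,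
and send the vertices of the simplex, which add up to zero, to the vertices in the relation. -/
theorem exists_projection_terminalSimplex {i : ℕ} {S : Set (Fin i → ℝ)} (hS : S.Finite)
    (hSZ : S ⊆ integerLattice i) (h0 : (0 : Fin i → ℝ) ∈ interior (convexHull ℝ S)) (d : ℕ) :
    ∃ n, d ≤ n ∧ ∃ π : (Fin n → ℝ) →ₗ[ℝ] (Fin i → ℝ), Function.Surjective π ∧
      (∀ z ∈ integerLattice n, π z ∈ integerLattice i) ∧
      ∀ t ∈ terminalSimplex n, π t ∈ convexHull ℝ S := by
  have := hS.fintype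
  obtain ⟨p, hp, hrel⟩ := exists_pos_int_relation hSZ h0
  obtain ⟨s₀, hs₀⟩ := convexHull_nonempty_iff.1 ⟨0, interior_subset h0⟩
  -- The factor `d + 1` makes the dimension at least `d`.
  let κ := Σ s : S, Fin ((d + 1) * p s)
  obtain ⟨n, hn⟩ : ∃ n, Fintype.card κ = d + n + 1 := by
    have h1 : Fintype.card κ = ∑ s, (d + 1) * p s := by simp [κ]
    have h2 : (d + 1) * p ⟨s₀, hs₀⟩ ≤ ∑ s, (d + 1) * p s :=
      Finset.single_le_sum (f := fun s => (d + 1) * p s) (fun _ _ => Nat.zero_le _) (Finset.mem_univ _)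
    have h3 : d + 1 ≤ (d + 1) * p ⟨s₀, hs₀⟩ := Nat.le_mul_of_pos_right _ (hp _)
    obtain ⟨n, hn⟩ := Nat.exists_eq_add_of_le (h3.trans h2)
    exact ⟨n, by omega⟩
  let E : κ ≃ Fin (d + n + 1) := Fintype.equivFinOfCardEq hn
  let w : Fin (d + n + 1) → Fin i → ℝ := fun a => (E.symm a).1
  have hwS : ∀ a, w a ∈ S := fun a => (E.symm a).1.2
  have hSw : ∀ s ∈ S, ∃ a, w a = s := fun s hs =>
    ⟨E ⟨⟨s, hs⟩, ⟨0, Nat.mul_pos d.succ_pos (hp _)⟩⟩, by simp [w]⟩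
  have hw0 : w 0 = -∑ j : Fin (d + n), w j.succ := by
    rw [eq_neg_iff_add_eq_zero, ← Fin.sum_univ_succ, E.symm.sum_comp fun b : κ => (b.1 : Fin i → ℝ),
      Fintype.sum_sigma]
    simp only [Finset.sum_const, Finset.card_univ, Fintype.card_fin, mul_smul]
    rw [← Finset.smul_sum]
    simp only [← Nat.cast_smul_eq_nsmul ℝ (p _)]
    rw [hrel, smul_zero]
  let π := Fintype.linearCombination ℝ (fun j : Fin (d + n) => w j.succ)
  have hπ : ∀ x, π x = ∑ j, x j • w j.succ := fun x => Fintype.linearCombination_apply ℝ _ x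
  refine ⟨d + n, Nat.le_add_right _ _, π, ?_, ?_, ?_⟩
  · rw [← LinearMap.range_eq_top, Fintype.range_linearCombination]
    refine Submodule.eq_top_of_nonempty_interior' _ ⟨0, interior_mono ?_ h0⟩
    refine convexHull_min ?_ (Submodule.convex _)
    intro s hs
    have hsucc : ∀ j : Fin (d + n), w j.succ ∈ Submodule.span ℝ
        (Set.range fun j : Fin (d + n) => w j.succ) := fun j => Submodule.subset_span ⟨j, rfl⟩
    obtain ⟨a, rfl⟩ := hSw s hs
    refine Fin.cases ?_ hsucc a
    rw [hw0]
    exact neg_mem (sum_mem fun j _ => hsucc j)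
  · rintro _ ⟨z, rfl⟩
    rw [hπ]
    exact Finset.sum_induction _ (· ∈ integerLattice i) (fun _ _ => add_mem_integerLattice)
      (zero_mem_integerLattice i) fun j _ => zsmul_mem_integerLattice _ (hSZ (hwS _))
  · intro t ht
    have hsub : terminalSimplex (d + n) ⊆ π ⁻¹' convexHull ℝ S := by
      refine convexHull_min ?_ ((convex_convexHull ℝ S).linear_preimage π)
      rintro _ (rfl | ⟨j, rfl⟩)
      · refine subset_convexHull ℝ S ?_
        rw [hπ]
        simp only [neg_one_smul, Finset.sum_neg_distrib]
        rw [← hw0]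
        exact hwS 0
      · refine subset_convexHull ℝ S ?_
        rw [Fintype.linearCombination_apply_single, one_smul]
        exact hwS _
    exact hsub ht

/-- Preimages of points under a projection `ℝⁿ → ℝⁱ` are flats of codimension `i`, so the `i`-th
covering minimum of `Tₙ` bounds the covering radius of a polytope that contains a lattice translate
of an image of `Tₙ`. -/
theorem coveringRadius_le_of_coveringMinimum {d : ℕ}
    (H : ∀ n : ℕ, d ≤ n → ∀ i : ℕ, 1 ≤ i → i ≤ d →
      coveringMinimum i (terminalSimplex n) (integerLattice n) = (i : ℝ) / 2)
    {i : ℕ} (hi0 : 1 ≤ i) (hi : i ≤ d) {P : Set (Fin i → ℝ)} (hP : IsLatticePolytope P)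
    (hPh : ¬ IsHollow P (integerLattice i)) :
    coveringRadius P (integerLattice i) ≤ (i : ℝ) / 2 := by
  obtain ⟨-, S, hS, hSZ, rfl⟩ := hP
  obtain ⟨z₀, hz₀, hz₀Z⟩ := Set.nonempty_iff_ne_empty.2 hPh
  have hS' : (-z₀ +ᵥ S).Finite := hS.vadd_set
  have hSZ' : -z₀ +ᵥ S ⊆ integerLattice i := by
    rintro _ ⟨s, hs, rfl⟩
    change -z₀ + s ∈ integerLattice i
    rw [neg_add_eq_sub]
    exact sub_mem_integerLattice (hSZ hs) hz₀Z
  have h0 : (0 : Fin i → ℝ) ∈ interior (convexHull ℝ (-z₀ +ᵥ S)) := by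
    rw [convexHull_vadd, interior_vadd]
    exact ⟨z₀, hz₀, by simp⟩
  obtain ⟨n, hdn, π, hπ, hπZ, hπT⟩ := exists_projection_terminalSimplex hS' hSZ' h0 d
  have hi' : (0 : ℝ) < i := by exact_mod_cast hi0
  have hmin := H n hdn i hi0 hi
  rw [coveringMinimum_eq] at hmin
  -- The infimum is positive, so it is not the junk value `sInf ∅ = 0`.
  have hne : {μ : ℝ | 0 ≤ μ ∧ MeetsFlats i μ (terminalSimplex n)}.Nonempty := by
    rw [Set.nonempty_iff_ne_empty]
    intro he
    rw [he, Real.sInf_empty] at hmin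
    linarith
  rw [← hmin]
  refine le_csInf hne fun μ hμ => csInf_le ⟨0, fun _ h => h.1⟩ ⟨hμ.1, ?_⟩
  refine Set.eq_univ_of_forall fun x => ?_
  obtain ⟨y, hy⟩ := hπ (x - μ • z₀)
  have hV : Module.finrank ℝ (LinearMap.ker π) + i = n := by
    have := LinearMap.finrank_range_add_finrank_ker π
    rw [LinearMap.range_eq_top.2 hπ, finrank_top, Module.finrank_fin_fun,
      Module.finrank_fin_fun] at this
    omega
  obtain ⟨v, hv, t, ht, z, hz, h⟩ := hμ.2 _ hV y
  have h1 := hπT t ht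
  rw [convexHull_vadd] at h1
  obtain ⟨s, hs, hst⟩ := h1
  have h2 := congrArg π h
  rw [map_add, map_add, LinearMap.mem_ker.1 hv, hy, map_smul, ← hst] at h2
  simp only [vadd_eq_add, add_zero, smul_add, smul_neg] at h2
  refine ⟨μ • s, Set.smul_mem_smul_set hs, π z, hπZ z hz, ?_⟩
  change μ • s + π z = x
  rw [sub_eq_iff_eq_add.1 h2]
  abel

/-! ### The equivalence -/

theorem coveringMinimum_isTerminalPolytope {d : ℕ}
    (H : ∀ i : ℕ, 1 ≤ i → i ≤ d → ∀ P : Set (Fin i → ℝ), IsLatticePolytope P →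
        ¬ IsHollow P (integerLattice i) → coveringRadius P (integerLattice i) ≤ (i : ℝ) / 2)
    {n : ℕ} (hn : d ≤ n) {T : Set (Fin n → ℝ)} (hT : IsTerminalPolytope T) {i : ℕ}
    (hi0 : 1 ≤ i) (hi : i ≤ d) : coveringMinimum i T (integerLattice n) = (i : ℝ) / 2 := by
  obtain ⟨-, k, l, e, u, -, hu, rfl⟩ := hT
  have hupper : ∀ ε : ℝ, 0 < ε → MeetsFlats i ((i : ℝ) / 2 + ε) (convexDirectSum fun j =>
      blockInclusion e j '' ((fun x => u j + x) '' terminalSimplex (l j))) := fun ε hε =>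
    meetsFlats_convexDirectSum e (fun j i hi ε hε =>
      (meetsFlats_of_coveringRadius_le H (finite_terminalVertices _) (terminalVertices_subset _)
        (zero_mem_interior_terminalSimplex (l j)) i hi ε hε).translate (u j)) hi0 hi hε
  rw [coveringMinimum_eq]
  refine le_antisymm (le_of_forall_pos_le_add fun ε hε => ?_) ?_
  · exact csInf_le ⟨0, fun _ h => h.1⟩ ⟨by positivity, hupper ε hε⟩
  · exact le_csInf ⟨_, by positivity, hupper 1 one_pos⟩ fun μ hμ =>
      half_le_of_meetsFlats e hu hi0 (hi.trans hn) hμ.1 hμ.2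

theorem proposition1p4 (d : ℕ) :
    List.TFAE [
      ∀ i : ℕ, 1 ≤ i → i ≤ d → ∀ P : Set (Fin i → ℝ), IsLatticePolytope P →
        ¬ IsHollow P (integerLattice i) → coveringRadius P (integerLattice i) ≤ (i : ℝ) / 2,
      ∀ n : ℕ, d ≤ n → ∀ i : ℕ, 1 ≤ i → i ≤ d →
        coveringMinimum i (terminalSimplex n) (integerLattice n) = (i : ℝ) / 2,
      ∀ n : ℕ, d ≤ n → ∀ T : Set (Fin n → ℝ), IsTerminalPolytope T → ∀ i : ℕ, 1 ≤ i → i ≤ d →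
        coveringMinimum i T (integerLattice n) = (i : ℝ) / 2] := by
  tfae_have 1 → 3 := fun H n hn T hT i hi0 hi => coveringMinimum_isTerminalPolytope H hn hT hi0 hi
  tfae_have 3 → 2 := fun H n hn i hi0 hi =>
    H n hn _ (terminalSimplex_isTerminalPolytope (by omega)) i hi0 hi
  tfae_have 2 → 1 := fun H i hi0 hi P hP hPh =>
    coveringRadius_le_of_coveringMinimum H hi0 hi hP hPh
  tfae_finish
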